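/- Let $\mathsf P^n=\{I,X,Y,Z\}^{\otimes n}$ be the set of $n$-qubit Pauli operators $P_a$. An $n$-qubit Pauli channel is a map $\Lambda(\rho)=\sum_{b\in\mathsf P^n}p_bP_b\rho P_b$ with $p_b\ge 0$ and $\sum_b p_b=1$; its Pauli eigenvalues are $\lambda_a=2^{-n}\mathrm{Tr}[P_a\Lambda(P_a)]$. For a non-empty $B\subseteq\mathsf P^n\setminus\{I\}$ put $$\lambda_B:=\mathrm{sgn}\Big(\prod_{b\in B}\lambda_b\Big)\,\Big|\prod_{b\in B}\lambda_b\Big|^{1/|B|}.$$ An entanglement-free (classical-memory-assisted) scheme using $M\ge1$ copies of a channel $\Lambda$ on $n$ qubits consists of finite outcome alphabets; an ensemble of positive semidefinite operators $\rho_{o_0}$ with total trace $1$; for $1\le t\le M-1$ and every string of previous outcomes $o_{<t}=(o_0,\dots,o_{t-1})$ a quantum instrument $\{\mathcal C^{o_{<t}}_{o_t}\}_{o_t}$ (completely positive maps on the $n$-qubit system whose sum is trace preserving); and for every $o_{<M}$ a POVM $\{E^{o_{<M}}_{o_M}\}_{o_M}$. Its outcome string $o=(o_0,\dots,o_M)$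 has distribution $$\Pr[o\,|\,\Lambda]=\mathrm{Tr}\Big[E^{o_{<M}}_{o_M}\big(\Lambda\circ\mathcal C^{o_{<M-1}}_{o_{M-1}}\circ\cdots\circ\Lambda\circ\mathcal C^{o_{<1}}_{o_1}\circ\Lambda\big)(\rho_{o_0})\Big],$$ and its estimates are real-valued functions of $o$. An instrument is trivial if each of its branches is proportional to a completely positive trace-preserving map. The number of measurements of the scheme is the maximum, over all outcome strings, of the number of non-trivial instruments used along the string, plus one for the final POVM. Theorem. There is a universal constant $c>0$ such that the following holds. Let $n\ge1$, let $\mathbf B$ be a partition of $\mathsf P^n\setminus\{I\}$ into non-empty blocks of size at most $C$, and let $0<\varepsilon\le 1/(6C)$. Suppose that an entanglement-free scheme, with any number of copies, has estimators $\widehat\lambda_B$, $B\in\mathbf B$, such that for every $n$-qubit Pauli channel $\Lambda$ and every single block $B\in\mathbf B$ $$\Pr\big[\,|\widehat\lambda_B-\lambda_B|\le\varepsilon\ \big|\ \Lambda\big]\ge\tfrac23 .$$ Then its number of measurements $N$ satisfies $N\ge c\,2^n\varepsilon^{-2}C^{-2}$. -/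

import Mathlib

noncomputable section

namespace PauliLearning

open scoped Matrix ComplexOrder

/-- Linear operators on the `n`-qubit Hilbert space, in the computational basis. -/
abbrev Op (n : ℕ) : Type := Matrix (Fin n → Fin 2) (Fin n → Fin 2) ℂ

/-- Linear maps on operators (superoperators). -/
abbrev SuperOp (n : ℕ) : Type := Op n →ₗ[ℂ] Op n

/-! ### Pauli operators and Pauli channels -/

/-- The `n`-qubit Pauli group modulo phase: the `k`-th entry is the pair `(a_{x,k}, a_{z,k})`.
The identity Pauli is `0`. -/
abbrev PauliIdx (n : ℕ) : Type := Fin n → ZMod 2 × ZMod 2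

/-- The single-qubit Pauli operator `i^{xz} X^x Z^z`, that is `I`, `Z`, `X`, `Y` for
`(x, z) = (0, 0), (0, 1), (1, 0), (1, 1)`. -/
def pauli1 (a : ZMod 2 × ZMod 2) : Matrix (Fin 2) (Fin 2) ℂ :=
  Complex.I ^ (a.1.val * a.2.val) •
    ((!![0, 1; 1, 0] : Matrix (Fin 2) (Fin 2) ℂ) ^ a.1.val *
      (!![1, 0; 0, -1] : Matrix (Fin 2) (Fin 2) ℂ) ^ a.2.val)

/-- The `n`-qubit Pauli operator `P_a`, the tensor product of single-qubit Paulis. -/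
def pauli {n : ℕ} (a : PauliIdx n) : Op n :=
  Matrix.of fun x y => ∏ k, pauli1 (a k) (x k) (y k)

/-- The map `ρ ↦ ∑_b p_b P_b ρ P_b`. It is a Pauli channel when the error rates `p` form a
probability vector. -/
def pauliChannel {n : ℕ} (p : PauliIdx n → ℝ) : SuperOp n :=
  ∑ b, (p b : ℂ) • (LinearMap.mulLeft ℂ (pauli b) ∘ₗ LinearMap.mulRight ℂ (pauli b))

/-- The Pauli eigenvalue (Pauli fidelity) `λ_a = Tr[P_a Λ(P_a)] / 2^n`. -/
def pauliEigenvalue {n : ℕ} (Λ : SuperOp n) (a : PauliIdx n) : ℝ :=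
  (pauli a * Λ (pauli a)).trace.re / 2 ^ n

/-- The geometrically averaged Pauli fidelity of a block `B`:
`sgn(∏_{b ∈ B} λ_b) * |∏_{b ∈ B} λ_b|^{1/|B|}`. -/
def geomFidelity {n : ℕ} (Λ : SuperOp n) (B : Finset (PauliIdx n)) : ℝ :=
  Real.sign (∏ b ∈ B, pauliEigenvalue Λ b) *
    |∏ b ∈ B, pauliEigenvalue Λ b| ^ ((1 : ℝ) / (B.card : ℝ))

/-! ### Channels and instruments -/

/-- Complete positivity: for every `k`, applying `Φ` to the blocks of a positive semidefinite
`k × k` block matrix gives a positive semidefinite block matrix. -/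
def IsCP {n : ℕ} (Φ : SuperOp n) : Prop :=
  ∀ (k : ℕ) (M : Matrix (Fin k) (Fin k) (Op n)),
    (Matrix.comp (Fin k) (Fin k) _ _ ℂ M).PosSemidef →
      (Matrix.comp (Fin k) (Fin k) _ _ ℂ (M.map Φ)).PosSemidef

/-- Trace preservation. -/
def IsTP {n : ℕ} (Φ : SuperOp n) : Prop :=
  ∀ ρ : Op n, (Φ ρ).trace = ρ.trace

/-- A quantum instrument with finitely many outcomes: completely positive maps whose sum is trace
preserving (hence each of them is trace non-increasing). -/
def IsInstrument {n : ℕ} {α : Type} [Fintype α] (Φ : α → SuperOp n) : Prop :=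
  (∀ o, IsCP (Φ o)) ∧ IsTP (∑ o, Φ o)

/-- An instrument is trivial if each of its branches is proportional to a CPTP map. -/
def IsTrivialInstrument {n : ℕ} {α : Type} (Φ : α → SuperOp n) : Prop :=
  ∀ o, ∃ (r : ℝ) (Ψ : SuperOp n), IsCP Ψ ∧ IsTP Ψ ∧ Φ o = (r : ℂ) • Ψ

/-- A POVM with finitely many outcomes. -/
def IsPOVM {n : ℕ} {α : Type} [Fintype α] (E : α → Op n) : Prop :=
  (∀ o, (E o).PosSemidef) ∧ ∑ o, E o = 1

/-- An ensemble of sub-normalized states with total trace one. -/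
def IsEnsemble {n : ℕ} {α : Type} [Fintype α] (ρ : α → Op n) : Prop :=
  (∀ o, (ρ o).PosSemidef) ∧ (∑ o, ρ o).trace = 1

/-! ### Classical-memory-assisted (entanglement-free) schemes -/

/-- Outcome strings `o_{<t} = (o_0, …, o_{t-1})`, where `o_i` takes values in `A i`. -/
abbrev History (A : ℕ → Type) (t : ℕ) : Type := (i : Fin t) → A i

/-- The prefix `o_{<s}` of an outcome string `o_{<t}`, for `s ≤ t`. -/
def History.take {A : ℕ → Type} {t : ℕ} (o : History A t) (s : ℕ) (h : s ≤ t) : History A s :=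
  fun i => o (Fin.castLE h i)

/-- A classical-memory-assisted scheme on `n` qubits that uses `m + 1` copies of the unknown
channel: an ensemble of initial states (outcome `o_0`), adaptively chosen instruments at the times
`t = 1, …, m` (outcome `o_t`), and an adaptively chosen final POVM (outcome `o_{m+1}`). The values
of `instr` at other times are never used. -/
structure Scheme (n m : ℕ) where
  /-- The finite outcome alphabets. -/
  A : ℕ → Type
  [fintypeA : ∀ i, Fintype (A i)]
  /-- The sub-normalized initial states `ρ_{o_0}`. -/
  init : A 0 → Op n
  init_ensemble : IsEnsemble init
  /-- The branches `C_{o_t}^{o_{<t}}` of the instruments. -/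
  instr : (t : ℕ) → History A t → A t → SuperOp n
  instr_instrument : ∀ t, 1 ≤ t → t ≤ m → ∀ h : History A t, IsInstrument (instr t h)
  /-- The final POVM elements `E_{o_{m+1}}^{o_{<m+1}}`. -/
  povm : History A (m + 1) → A (m + 1) → Op n
  povm_povm : ∀ h, IsPOVM (povm h)

attribute [instance] Scheme.fintypeA

namespace Scheme

variable {n m : ℕ} (S : Scheme n m)

/-- Complete outcome strings `(o_0, …, o_{m+1})`. -/
abbrev Outcome : Type := History S.A (m + 2)

/-- The unnormalized state `(C_{o_t}^{o_{<t}} ∘ Λ ∘ ⋯ ∘ C_{o_1}^{o_0} ∘ Λ)(ρ_{o_0})`, as a function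
of the outcomes `(o_0, …, o_t)`. -/
def state (Λ : SuperOp n) : (t : ℕ) → History S.A (t + 1) → Op n
  | 0, o => S.init (o (Fin.last 0))
  | t + 1, o =>
      S.instr (t + 1) (o.take (t + 1) (Nat.le_succ _)) (o (Fin.last (t + 1)))
        (Λ (state Λ t (o.take (t + 1) (Nat.le_succ _))))

/-- The probability `Pr[o | Λ]` of a complete outcome string. -/
def prob (Λ : SuperOp n) (o : S.Outcome) : ℝ :=
  (S.povm (o.take (m + 1) (Nat.le_succ _)) (o (Fin.last (m + 1))) *
    Λ (S.state Λ m (o.take (m + 1) (Nat.le_succ _)))).trace.re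

open Classical in
/-- The probability of an event, that is, of a set of complete outcome strings. -/
def probEvent (Λ : SuperOp n) (s : Set S.Outcome) : ℝ :=
  ∑ o : S.Outcome, if o ∈ s then S.prob Λ o else 0

open Classical in
/-- The number of measurements: the worst case, over all outcome strings, of the number of
non-trivial instruments used, where the final POVM is counted as well. -/
def numMeas : ℕ :=
  (Finset.univ : Finset (History S.A (m + 1))).sup fun o =>
    ((Finset.univ : Finset (Fin (m + 1))).filter fun t : Fin (m + 1) =>
      1 ≤ (t : ℕ) ∧ ¬ IsTrivialInstrument (S.instr t (o.take (t : ℕ) t.isLt.le))).card + 1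

/-- With outputs `est B` computed from the outcome string, the scheme estimates, for every Pauli
channel and every block `B` of the partition, the geometrically averaged Pauli fidelity of `B` to
additive precision `ε` with probability at least `2/3` (for each block individually). -/
def Learns (𝓑 : Finset (Finset (PauliIdx n))) (est : Finset (PauliIdx n) → S.Outcome → ℝ)
    (ε : ℝ) : Prop :=
  ∀ p ∈ stdSimplex ℝ (PauliIdx n), ∀ B ∈ 𝓑,
    2 / 3 ≤ S.probEvent (pauliChannel p)
      {o | |est B o - geomFidelity (pauliChannel p) B| ≤ ε}

end Scheme

end PauliLearning

end

/-!
For a block `B` of non-identity Paulis and `0 < η ≤ 1 / (2 |B|)`, the map with Pauli eigenvalues `1`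
at the identity, `η` on `B` and `0` elsewhere is a Pauli channel whose averaged fidelity of `B` is
`η`. With `η = 3ε`, a successful scheme must distinguish it from the completely depolarizing
channel `Λ₀`, so the relative entropy `D(Λ₀‖Λ_B)` between the two laws of the outcome string is
bounded below by a constant.

By the chain rule, `D(Λ₀‖Λ_B)` is a sum over the measurements. An effect `E` sees the relative
change of probability `η ∑_{b ∈ B} x_b e_b`, where `x` and `e` are the Pauli expectation values of
the incoming state and of `E / Tr E`. Since `|x_b| ≤ 1`, Cauchy–Schwarz bounds its square by
`η² |B| ∑_{b ∈ B} e_b²`, in which the state no longer appears. Because the outcomes are averaged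
under `Λ₀`, which does not depend on `B`, these bounds can be summed over all blocks at once, and
`∑_b e_b² ≤ 2^n` (purity is at most one) leaves a total of at most `2^n` per measurement. A trivial
instrument has effects proportional to the identity and contributes nothing.
-/

noncomputable section

namespace PauliLearning

open scoped Matrix ComplexOrder

/-! ### Traces of positive semidefinite matrices -/

section Trace

variable {ι 𝕜 : Type*} [Fintype ι] [RCLike 𝕜]

lemma star_trace_mul {X Y : Matrix ι ι 𝕜} (hX : X.IsHermitian) (hY : Y.IsHermitian) :
    star (X * Y).trace = (X * Y).trace := by
  rw [← Matrix.trace_conjTranspose, Matrix.conjTranspose_mul, hX.eq, hY.eq, Matrix.trace_mul_comm]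

lemma trace_mul_self_le_sq_trace {X : Matrix ι ι 𝕜} (hX : X.PosSemidef) :
    (X * X).trace ≤ X.trace ^ 2 := by
  simp only [sq, Matrix.trace, Matrix.diag, Matrix.mul_apply, Finset.sum_mul_sum]
  refine Finset.sum_le_sum fun i _ => Finset.sum_le_sum fun j _ => ?_
  have hminor := (hX.submatrix ![i, j]).det_nonneg
  rw [Matrix.det_fin_two] at hminor
  simpa using hminor

open scoped MatrixOrder in
lemma trace_mul_nonneg {X Y : Matrix ι ι 𝕜} (hX : X.PosSemidef) (hY : Y.PosSemidef) :
    0 ≤ (X * Y).trace := by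
  classical
  obtain ⟨B, rfl⟩ := CStarAlgebra.nonneg_iff_eq_star_mul_self.mp hY.nonneg
  rw [← mul_assoc, Matrix.trace_mul_comm, ← mul_assoc]
  exact (hX.mul_mul_conjTranspose_same B).trace_nonneg

lemma isHermitian_of_forall_star_dotProduct_mulVec {A : Matrix ι ι ℂ}
    (hA : ∀ v, (star v ⬝ᵥ A *ᵥ v).im = 0) : A.IsHermitian := by
  classical
  rw [← Matrix.isSymmetric_toEuclideanLin_iff, LinearMap.isSymmetric_iff_inner_map_self_real]
  intro v
  have hinner : inner ℂ (A.toEuclideanLin v) v = star (star v.ofLp ⬝ᵥ A *ᵥ v.ofLp) := by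
    rw [EuclideanSpace.inner_eq_star_dotProduct, dotProduct_comm, Matrix.star_dotProduct]
    rfl
  rw [hinner, Complex.conj_eq_iff_im]
  simp [hA]

lemma posSemidef_of_forall_trace_mul_nonneg {A : Matrix ι ι ℂ}
    (hA : ∀ X : Matrix ι ι ℂ, X.PosSemidef → 0 ≤ (A * X).trace) : A.PosSemidef := by
  classical
  have hquad : ∀ v, 0 ≤ star v ⬝ᵥ A *ᵥ v := fun v => by
    have h := hA _ (Matrix.posSemidef_vecMulVec_self_star v)
    rwa [Matrix.mul_vecMulVec, Matrix.trace_vecMulVec, dotProduct_comm] at h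
  exact .of_dotProduct_mulVec_nonneg (isHermitian_of_forall_star_dotProduct_mulVec fun v =>
    (Complex.nonneg_iff.1 (hquad v)).2.symm) hquad

lemma posSemidef_one_add_of_mul_self_eq_one [DecidableEq ι] {U : Matrix ι ι 𝕜} (hU : U.IsHermitian)
    (hUU : U * U = 1) : (1 + U).PosSemidef := by
  have h : (1 + U) = (2⁻¹ : 𝕜) • ((1 + U)ᴴ * (1 + U)) := by
    rw [Matrix.conjTranspose_add, Matrix.conjTranspose_one, hU.eq, eq_inv_smul_iff₀ two_ne_zero,
      add_mul, mul_add, mul_add, hUU, two_smul]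
    simp only [one_mul, mul_one]
    abel
  rw [h]
  exact (Matrix.posSemidef_conjTranspose_mul_self _).smul (by positivity)

lemma re_trace_nonneg {X : Matrix ι ι 𝕜} (hX : X.PosSemidef) : 0 ≤ RCLike.re X.trace :=
  (RCLike.nonneg_iff.1 hX.trace_nonneg).1

lemma abs_re_trace_mul_le [DecidableEq ι] {X U : Matrix ι ι 𝕜} (hX : X.PosSemidef)
    (hU : U.IsHermitian) (hUU : U * U = 1) : |RCLike.re (X * U).trace| ≤ RCLike.re X.trace := by
  have hadd := trace_mul_nonneg hX (posSemidef_one_add_of_mul_self_eq_one hU hUU)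
  have hsub := trace_mul_nonneg hX
    (posSemidef_one_add_of_mul_self_eq_one hU.neg (by rwa [neg_mul_neg]))
  rw [mul_add, mul_one, Matrix.trace_add, RCLike.nonneg_iff, map_add] at hadd hsub
  rw [mul_neg, Matrix.trace_neg, map_neg] at hsub
  exact abs_le.2 ⟨by linarith [hadd.1], by linarith [hsub.1]⟩

end Trace

/-! ### Pauli operators -/

section PiKronecker

variable {κ ι R : Type*} [Fintype κ] [CommSemiring R]

/-- The tensor product of a finite family of matrices. -/
def piKronecker (f : κ → Matrix ι ι R) : Matrix (κ → ι) (κ → ι) R :=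
  Matrix.of fun x y => ∏ k, f k (x k) (y k)

lemma piKronecker_mul [DecidableEq κ] [Fintype ι] (f g : κ → Matrix ι ι R) :
    piKronecker f * piKronecker g = piKronecker fun k => f k * g k := by
  ext x y
  simp only [piKronecker, Matrix.mul_apply, Matrix.of_apply, Fintype.prod_sum,
    Finset.prod_mul_distrib]

lemma trace_piKronecker [DecidableEq κ] [Fintype ι] (f : κ → Matrix ι ι R) :
    (piKronecker f).trace = ∏ k, (f k).trace := by
  simp only [piKronecker, Matrix.trace, Matrix.diag, Matrix.of_apply, Fintype.prod_sum]

lemma piKronecker_one [DecidableEq ι] :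
    piKronecker (fun _ : κ => (1 : Matrix ι ι R)) = 1 := by
  ext x y
  simp [piKronecker, Matrix.one_apply, Finset.prod_boole, funext_iff]

lemma piKronecker_smul (c : κ → R) (f : κ → Matrix ι ι R) :
    piKronecker (fun k => c k • f k) = (∏ k, c k) • piKronecker f := by
  ext x y
  simp [piKronecker, Finset.prod_mul_distrib]

lemma conjTranspose_piKronecker [StarRing R] (f : κ → Matrix ι ι R) :
    (piKronecker f)ᴴ = piKronecker fun k => (f k)ᴴ := by
  ext x y
  simp [piKronecker, Matrix.conjTranspose_apply, star_prod]

end PiKronecker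

lemma prod_ite_const {κ M : Type*} [Fintype κ] [CommMonoidWithZero M] (q : κ → Prop)
    [DecidablePred q] (c : M) :
    ∏ k, (if q k then c else 0) = if ∀ k, q k then c ^ Fintype.card κ else 0 := by
  split_ifs with hq
  · simp [hq]
  · obtain ⟨k, hk⟩ := not_forall.1 hq
    exact Finset.prod_eq_zero (Finset.mem_univ k) (if_neg hk)

lemma sum_zmod_two_prod {M : Type*} [AddCommMonoid M] (f : ZMod 2 × ZMod 2 → M) :
    ∑ a, f a = f (0, 0) + f (0, 1) + (f (1, 0) + f (1, 1)) := by
  rw [Fintype.sum_prod_type]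
  have hsum : ∀ g : ZMod 2 → M, ∑ x, g x = g 0 + g 1 := fun g => Fin.sum_univ_two g
  rw [hsum, hsum, hsum]

lemma forall_zmod_two_prod {q : ZMod 2 × ZMod 2 → Prop} (h00 : q (0, 0)) (h01 : q (0, 1))
    (h10 : q (1, 0)) (h11 : q (1, 1)) (a : ZMod 2 × ZMod 2) : q a := by
  obtain ⟨x, z⟩ := a
  fin_cases x <;> fin_cases z <;> assumption

lemma zmod_two_val_one : (1 : ZMod 2).val = 1 := rfl

lemma pauli1_zero_zero : pauli1 (0, 0) = !![1, 0; 0, 1] := by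
  simp [pauli1, Matrix.one_fin_two]

lemma pauli1_zero_one : pauli1 (0, 1) = !![1, 0; 0, -1] := by
  simp [pauli1, zmod_two_val_one]

lemma pauli1_one_zero : pauli1 (1, 0) = !![0, 1; 1, 0] := by
  simp [pauli1, zmod_two_val_one]

lemma pauli1_one_one : pauli1 (1, 1) = !![0, -Complex.I; Complex.I, 0] := by
  simp [pauli1, zmod_two_val_one]

lemma pauli1_zero : pauli1 0 = 1 :=
  pauli1_zero_zero.trans Matrix.one_fin_two.symm

lemma sum_pauli1_mul_pauli1 (i j k l : Fin 2) :
    ∑ a, pauli1 a i j * pauli1 a k l = if i = l ∧ j = k then 2 else 0 := by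
  rw [sum_zmod_two_prod, pauli1_zero_zero, pauli1_zero_one, pauli1_one_zero, pauli1_one_one]
  fin_cases i <;> fin_cases j <;> fin_cases k <;> fin_cases l <;> norm_num

lemma isHermitian_pauli1 (a : ZMod 2 × ZMod 2) : (pauli1 a).IsHermitian := by
  ext i j
  induction a using forall_zmod_two_prod <;>
  simp only [pauli1_zero_zero, pauli1_zero_one, pauli1_one_zero, pauli1_one_one] <;>
  fin_cases i <;> fin_cases j <;> simp

lemma pauli1_mul_self (a : ZMod 2 × ZMod 2) : pauli1 a * pauli1 a = 1 := by
  induction a using forall_zmod_two_prod <;>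
  simp [pauli1_zero_zero, pauli1_zero_one, pauli1_one_zero, pauli1_one_one, Matrix.one_fin_two]

lemma trace_pauli1 (a : ZMod 2 × ZMod 2) : (pauli1 a).trace = if a = 0 then 2 else 0 := by
  induction a using forall_zmod_two_prod <;>
  simp [pauli1_zero_zero, pauli1_zero_one, pauli1_one_zero, pauli1_one_one,
    Matrix.trace_fin_two, one_add_one_eq_two]

/-- The sign with which two single-qubit Pauli operators commute, given by the symplectic form of
their indices. -/
def commSign1 (a b : ZMod 2 × ZMod 2) : ℝ := (-1) ^ (a.1 * b.2 + a.2 * b.1).val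

lemma abs_commSign1 (a b : ZMod 2 × ZMod 2) : |commSign1 a b| = 1 := by
  simp [commSign1]

lemma pauli1_conj (a b : ZMod 2 × ZMod 2) :
    pauli1 b * pauli1 a * pauli1 b = (commSign1 a b : ℂ) • pauli1 a := by
  have htwo : (1 + 1 : ZMod 2) = 0 := rfl
  induction a using forall_zmod_two_prod <;> induction b using forall_zmod_two_prod <;>
  simp [pauli1_zero_zero, pauli1_zero_one, pauli1_one_zero, pauli1_one_one, commSign1,
    zmod_two_val_one, htwo]

lemma sum_commSign1_mul_commSign1 (a c : ZMod 2 × ZMod 2) :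
    ∑ b, commSign1 a b * commSign1 c b = if a = c then 4 else 0 := by
  have htwo : (1 + 1 : ZMod 2) = 0 := rfl
  rw [sum_zmod_two_prod]
  induction a using forall_zmod_two_prod <;> induction c using forall_zmod_two_prod <;>
  simp [commSign1, zmod_two_val_one, htwo] <;> norm_num

variable {n : ℕ}

lemma pauli_eq_piKronecker (a : PauliIdx n) : pauli a = piKronecker fun k => pauli1 (a k) := rfl

lemma pauli_zero : pauli (0 : PauliIdx n) = 1 := by
  simp only [pauli_eq_piKronecker, Pi.zero_apply, pauli1_zero, piKronecker_one]

lemma isHermitian_pauli (a : PauliIdx n) : (pauli a).IsHermitian := by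
  simp only [Matrix.IsHermitian, pauli_eq_piKronecker, conjTranspose_piKronecker,
    (isHermitian_pauli1 _).eq]

lemma pauli_mul_self (a : PauliIdx n) : pauli a * pauli a = 1 := by
  simp only [pauli_eq_piKronecker, piKronecker_mul, pauli1_mul_self, piKronecker_one]

lemma trace_pauli (a : PauliIdx n) : (pauli a).trace = if a = 0 then 2 ^ n else 0 := by
  simp only [pauli_eq_piKronecker, trace_piKronecker, trace_pauli1, prod_ite_const, funext_iff,
    Fintype.card_fin, Pi.zero_apply]

/-- The sign with which two Pauli operators commute. -/
def commSign (a b : PauliIdx n) : ℝ := ∏ k, commSign1 (a k) (b k)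

lemma commSign_zero_left (b : PauliIdx n) : commSign 0 b = 1 := by
  simp [commSign, commSign1]

lemma abs_commSign (a b : PauliIdx n) : |commSign a b| = 1 := by
  simp [commSign, Finset.abs_prod, abs_commSign1]

lemma pauli_conj (a b : PauliIdx n) :
    pauli b * pauli a * pauli b = (commSign a b : ℂ) • pauli a := by
  simp only [pauli_eq_piKronecker, piKronecker_mul, pauli1_conj, piKronecker_smul, commSign,
    Complex.ofReal_prod]

lemma sum_commSign_mul_commSign (a c : PauliIdx n) :
    ∑ b, commSign a b * commSign c b = if a = c then 4 ^ n else 0 := by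
  simp only [commSign, ← Finset.prod_mul_distrib]
  rw [← Fintype.prod_sum fun k b => commSign1 (a k) b * commSign1 (c k) b]
  simp only [sum_commSign1_mul_commSign1, prod_ite_const, funext_iff, Fintype.card_fin]

-- The operators `P_a ⊗ P_a` add up to `2^n` times the swap of the two tensor factors.
lemma sum_pauli_mul_pauli (i j k l : Fin n → Fin 2) :
    ∑ a : PauliIdx n, pauli a i j * pauli a k l = if i = l ∧ j = k then 2 ^ n else 0 := by
  simp only [pauli, Matrix.of_apply, ← Finset.prod_mul_distrib]
  rw [← Fintype.prod_sum fun q a => pauli1 a (i q) (j q) * pauli1 a (k q) (l q)]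
  simp only [sum_pauli1_mul_pauli1, prod_ite_const, funext_iff, forall_and, Fintype.card_fin]

lemma sum_trace_smul_pauli (X : Op n) :
    ∑ a : PauliIdx n, (X * pauli a).trace • pauli a = (2 ^ n : ℂ) • X := by
  ext k l
  have hentry : ∀ i j, ∑ a : PauliIdx n, X j i * pauli a i j * pauli a k l =
      X j i * if i = l ∧ j = k then 2 ^ n else 0 := fun i j => by
    simp only [mul_assoc, ← Finset.mul_sum, sum_pauli_mul_pauli]
  calc (∑ a : PauliIdx n, (X * pauli a).trace • pauli a) k l
      = ∑ j, ∑ i, ∑ a : PauliIdx n, X j i * pauli a i j * pauli a k l := by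
        simp only [Matrix.sum_apply, Matrix.smul_apply, Matrix.trace, Matrix.diag,
          Matrix.mul_apply, smul_eq_mul, Finset.sum_mul]
        rw [Finset.sum_comm]
        exact Finset.sum_congr rfl fun j _ => Finset.sum_comm
    _ = ((2 ^ n : ℂ) • X) k l := by
        simp only [hentry, ite_and]
        simp [mul_comm]

/-- The coefficient `Tr[X P_a]` of a Hermitian operator `X` in the Pauli basis. The real part is
taken so that the coefficients are real by definition. -/
def pauliCoeff (X : Op n) (a : PauliIdx n) : ℝ := (X * pauli a).trace.re

lemma pauliCoeff_zero_right (X : Op n) : pauliCoeff X 0 = X.trace.re := by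
  rw [pauliCoeff, pauli_zero, mul_one]

lemma pauliCoeff_pauli_self (a : PauliIdx n) : pauliCoeff (pauli a) a = 2 ^ n := by
  rw [pauliCoeff, pauli_mul_self, Matrix.trace_one, Complex.natCast_re]
  simp

lemma trace_mul_pauli {X : Op n} (hX : X.IsHermitian) (a : PauliIdx n) :
    (X * pauli a).trace = pauliCoeff X a :=
  (Complex.conj_eq_iff_re.1 (star_trace_mul hX (isHermitian_pauli a))).symm

lemma abs_pauliCoeff_le {X : Op n} (hX : X.PosSemidef) (a : PauliIdx n) :
    |pauliCoeff X a| ≤ X.trace.re :=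
  abs_re_trace_mul_le hX (isHermitian_pauli a) (pauli_mul_self a)

lemma sum_pauliCoeff_mul_pauliCoeff {X : Op n} (hX : X.IsHermitian) (Y : Op n) :
    ∑ a, pauliCoeff X a * pauliCoeff Y a = 2 ^ n * (Y * X).trace.re := by
  have hcomplex : ∑ a, (pauliCoeff X a : ℂ) * (Y * pauli a).trace =
      ((2 ^ n : ℝ) : ℂ) * (Y * X).trace := by
    have h := congrArg (fun Z => (Y * Z).trace) (sum_trace_smul_pauli X)
    simpa [Finset.mul_sum, Matrix.trace_sum, trace_mul_pauli hX] using h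
  have hreal := congrArg Complex.re hcomplex
  rwa [Complex.re_sum, Complex.re_ofReal_mul,
    Finset.sum_congr rfl fun a _ => Complex.re_ofReal_mul _ _] at hreal

lemma sum_sq_pauliCoeff_le {X : Op n} (hX : X.PosSemidef) :
    ∑ a, pauliCoeff X a ^ 2 ≤ 2 ^ n * X.trace.re ^ 2 := by
  have hpurity : (X * X).trace.re ≤ (X.trace ^ 2).re :=
    (Complex.le_def.1 (trace_mul_self_le_sq_trace hX)).1
  have htrace : (X.trace ^ 2).re = X.trace.re ^ 2 := by
    have him : X.trace.im = 0 := (Complex.nonneg_iff.1 hX.trace_nonneg).2.symm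
    simp [sq, him]
  simp only [sq (pauliCoeff X _), sum_pauliCoeff_mul_pauliCoeff hX.1]
  exact mul_le_mul_of_nonneg_left (hpurity.trans htrace.le) (by positivity)

/-! ### Pauli channels -/

lemma pauliChannel_apply (p : PauliIdx n → ℝ) (X : Op n) :
    pauliChannel p X = ∑ b, (p b : ℂ) • (pauli b * X * pauli b) := by
  simp [pauliChannel, LinearMap.sum_apply, mul_assoc]

lemma trace_pauliChannel_mul_pauli (p : PauliIdx n → ℝ) (X : Op n) (a : PauliIdx n) :
    (pauliChannel p X * pauli a).trace =
      ((∑ b, p b * commSign a b : ℝ) : ℂ) * (X * pauli a).trace := by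
  have hconj : ∀ b, (pauli b * X * pauli b * pauli a).trace =
      commSign a b * (X * pauli a).trace := fun b => by
    rw [mul_assoc, mul_assoc, Matrix.trace_mul_comm, mul_assoc, mul_assoc, ← mul_assoc (pauli b),
      pauli_conj, Matrix.mul_smul, Matrix.trace_smul, smul_eq_mul]
  rw [pauliChannel_apply, Finset.sum_mul, Matrix.trace_sum, Complex.ofReal_sum, Finset.sum_mul]
  refine Finset.sum_congr rfl fun b _ => ?_
  rw [Matrix.smul_mul, Matrix.trace_smul, hconj, smul_eq_mul, Complex.ofReal_mul, mul_assoc]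

lemma pauliEigenvalue_pauliChannel (p : PauliIdx n → ℝ) (a : PauliIdx n) :
    pauliEigenvalue (pauliChannel p) a = ∑ b, p b * commSign a b := by
  rw [pauliEigenvalue, Matrix.trace_mul_comm, trace_pauliChannel_mul_pauli, Complex.re_ofReal_mul,
    ← pauliCoeff, pauliCoeff_pauli_self, mul_div_cancel_right₀ _ (by positivity)]

lemma pauliCoeff_pauliChannel (p : PauliIdx n → ℝ) (X : Op n) (a : PauliIdx n) :
    pauliCoeff (pauliChannel p X) a = pauliEigenvalue (pauliChannel p) a * pauliCoeff X a := by
  rw [pauliCoeff, trace_pauliChannel_mul_pauli, Complex.re_ofReal_mul,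
    pauliEigenvalue_pauliChannel, pauliCoeff]

lemma two_pow_mul_re_trace_mul_pauliChannel (p : PauliIdx n → ℝ) {E : Op n} (hE : E.IsHermitian)
    (X : Op n) :
    2 ^ n * (E * pauliChannel p X).trace.re =
      ∑ a, pauliEigenvalue (pauliChannel p) a * (pauliCoeff E a * pauliCoeff X a) := by
  rw [Matrix.trace_mul_comm, ← sum_pauliCoeff_mul_pauliCoeff hE]
  simp only [pauliCoeff_pauliChannel, mul_left_comm]

lemma isTP_pauliChannel {p : PauliIdx n → ℝ} (hp : ∑ b, p b = 1) : IsTP (pauliChannel p) := by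
  intro X
  have h := trace_pauliChannel_mul_pauli p X 0
  simpa only [pauli_zero, mul_one, commSign_zero_left, hp, Complex.ofReal_one, one_mul] using h

lemma posSemidef_pauliChannel {p : PauliIdx n → ℝ} (hp : ∀ b, 0 ≤ p b) {X : Op n}
    (hX : X.PosSemidef) : (pauliChannel p X).PosSemidef := by
  rw [pauliChannel_apply]
  refine Matrix.posSemidef_sum _ fun b _ => ?_
  have hconj := hX.mul_mul_conjTranspose_same (pauli b)
  rw [(isHermitian_pauli b).eq] at hconj
  exact hconj.smul (Complex.zero_le_real.2 (hp b))

/-- The error rates of the Pauli map with prescribed Pauli eigenvalues `f`. -/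
def pauliRates (f : PauliIdx n → ℝ) (b : PauliIdx n) : ℝ := (∑ a, f a * commSign a b) / 4 ^ n

lemma sum_pauliRates_mul_commSign (f : PauliIdx n → ℝ) (a : PauliIdx n) :
    ∑ b, pauliRates f b * commSign a b = f a := by
  calc ∑ b, pauliRates f b * commSign a b
      = ∑ c, f c * (∑ b, commSign c b * commSign a b) / 4 ^ n := by
        simp only [pauliRates, Finset.sum_div, Finset.sum_mul, Finset.mul_sum]
        rw [Finset.sum_comm]
        exact Finset.sum_congr rfl fun c _ => Finset.sum_congr rfl fun b _ => by ring
    _ = f a := by simp [sum_commSign_mul_commSign, ite_div]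

lemma sum_pauliRates (f : PauliIdx n → ℝ) : ∑ b, pauliRates f b = f 0 := by
  simpa only [commSign_zero_left, mul_one] using sum_pauliRates_mul_commSign f 0

lemma pauliEigenvalue_pauliRates (f : PauliIdx n → ℝ) (a : PauliIdx n) :
    pauliEigenvalue (pauliChannel (pauliRates f)) a = f a := by
  rw [pauliEigenvalue_pauliChannel, sum_pauliRates_mul_commSign]

/-- The Pauli eigenvalues of the hard instance that hides the signal `η` in the block `B` of
non-identity Paulis: `1` at the identity, `η` on `B`, and `0` elsewhere. For `η = 0` this is the
completely depolarizing channel. -/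
def blockSpectrum (η : ℝ) (B : Finset (PauliIdx n)) (a : PauliIdx n) : ℝ :=
  (if a = 0 then 1 else 0) + if a ∈ B then η else 0

/-- The hard instance with Pauli eigenvalues `blockSpectrum η B`. -/
def blockChannel (η : ℝ) (B : Finset (PauliIdx n)) : SuperOp n :=
  pauliChannel (pauliRates (blockSpectrum η B))

lemma pauliEigenvalue_blockChannel (η : ℝ) (B : Finset (PauliIdx n)) (a : PauliIdx n) :
    pauliEigenvalue (blockChannel η B) a = blockSpectrum η B a :=
  pauliEigenvalue_pauliRates _ a

/-- The completely depolarizing channel, which applies a uniformly random Pauli operator. -/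
def depolarizing (n : ℕ) : SuperOp n := pauliChannel fun _ => 1 / 4 ^ n

lemma blockChannel_zero (B : Finset (PauliIdx n)) : blockChannel 0 B = depolarizing n := by
  have hrates : pauliRates (blockSpectrum 0 B) = fun _ => 1 / 4 ^ n := by
    ext b
    simp [pauliRates, blockSpectrum, commSign_zero_left]
  rw [blockChannel, hrates, depolarizing]

lemma blockRates_mem_stdSimplex {η : ℝ} {B : Finset (PauliIdx n)} (hB : 0 ∉ B)
    (hη : |η| * B.card ≤ 1) : pauliRates (blockSpectrum η B) ∈ stdSimplex ℝ (PauliIdx n) := by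
  constructor
  · intro b
    have hsigns : |∑ a ∈ B, η * commSign a b| ≤ 1 := by
      refine (Finset.abs_sum_le_sum_abs _ _).trans ?_
      simpa [abs_mul, abs_commSign, mul_comm] using hη
    have hnum : ∑ a, blockSpectrum η B a * commSign a b = 1 + ∑ a ∈ B, η * commSign a b := by
      simp [blockSpectrum, add_mul, ite_mul, Finset.sum_add_distrib, commSign_zero_left]
    rw [pauliRates, hnum]
    have := (abs_le.1 hsigns).1
    exact div_nonneg (by linarith) (by positivity)
  · simp [sum_pauliRates, blockSpectrum, hB]

lemma geomFidelity_of_forall_eq {Λ : SuperOp n} {η : ℝ} {B : Finset (PauliIdx n)}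
    (hB : B.Nonempty) (hη : 0 ≤ η) (hΛ : ∀ b ∈ B, pauliEigenvalue Λ b = η) :
    geomFidelity Λ B = η := by
  have hcard : B.card ≠ 0 := hB.card_ne_zero
  rw [geomFidelity, Finset.prod_congr rfl hΛ, Finset.prod_const]
  rcases hη.eq_or_lt with rfl | hpos
  · simp [hcard]
  · rw [Real.sign_of_pos (by positivity), abs_of_pos (by positivity), one_mul, one_div,
      Real.pow_rpow_inv_natCast hη hcard]

lemma geomFidelity_blockChannel {η : ℝ} {B : Finset (PauliIdx n)} (hB : 0 ∉ B)
    (hne : B.Nonempty) (hη : 0 ≤ η) : geomFidelity (blockChannel η B) B = η :=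
  geomFidelity_of_forall_eq hne hη fun b hb => by
    rw [pauliEigenvalue_blockChannel, blockSpectrum, if_neg (ne_of_mem_of_not_mem hb hB),
      if_pos hb, zero_add]

lemma two_pow_mul_re_trace_mul_blockChannel (η : ℝ) (B : Finset (PauliIdx n)) {E : Op n}
    (hE : E.IsHermitian) (X : Op n) :
    2 ^ n * (E * blockChannel η B X).trace.re =
      E.trace.re * X.trace.re + η * ∑ b ∈ B, pauliCoeff E b * pauliCoeff X b := by
  rw [blockChannel, two_pow_mul_re_trace_mul_pauliChannel _ hE]
  simp [pauliEigenvalue_pauliRates, blockSpectrum, add_mul, ite_mul, Finset.sum_add_distrib,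
    pauliCoeff_zero_right, Finset.mul_sum]

/-! ### Relative entropy -/

section RelEntropy

variable {ι κ : Type*} [Fintype ι] [Fintype κ]

/-- The relative entropy `D(p‖q)` of two finite families of non-negative reals. It is meaningful
only if `p` vanishes wherever `q` does: elsewhere the value `∞` becomes `0` here. -/
def relEntropy (p q : ι → ℝ) : ℝ := ∑ i, p i * Real.log (p i / q i)

lemma relEntropy_self (p : ι → ℝ) : relEntropy p p = 0 :=
  Finset.sum_eq_zero fun i _ => by
    by_cases hp : p i = 0
    · rw [hp, zero_mul]
    · rw [div_self hp, Real.log_one, mul_zero]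

lemma relEntropy_comp_equiv (e : κ ≃ ι) (p q : ι → ℝ) :
    relEntropy (fun k => p (e k)) (fun k => q (e k)) = relEntropy p q :=
  e.sum_comp fun i => p i * Real.log (p i / q i)

lemma relEntropy_chain {P Q : ι → ℝ} {p q : ι → κ → ℝ} (hPQ : ∀ i, Q i = 0 → P i = 0)
    (hpq : ∀ i k, q i k = 0 → p i k = 0) (hp : ∀ i, ∑ k, p i k = 1) :
    relEntropy (fun x : ι × κ => P x.1 * p x.1 x.2) (fun x => Q x.1 * q x.1 x.2) =
      relEntropy P Q + ∑ i, P i * relEntropy (p i) (q i) := by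
  have hlog : ∀ i k, P i * p i k * Real.log (P i * p i k / (Q i * q i k)) =
      P i * Real.log (P i / Q i) * p i k + P i * (p i k * Real.log (p i k / q i k)) := by
    intro i k
    by_cases hP : P i = 0
    · simp [hP]
    by_cases hk : p i k = 0
    · simp [hk]
    rw [mul_div_mul_comm, Real.log_mul (div_ne_zero hP (mt (hPQ i) hP))
      (div_ne_zero hk (mt (hpq i k) hk))]
    ring
  simp only [relEntropy, Fintype.sum_prod_type, hlog, Finset.sum_add_distrib, ← Finset.mul_sum, hp,
    mul_one]

-- The easy half of the Gibbs variational principle, with `w` in place of `exp f`.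
lemma sum_mul_log_add_sum_sub_sum_le_relEntropy {p q w : ι → ℝ} (hp : ∀ i, 0 ≤ p i)
    (hq : ∀ i, 0 ≤ q i) (hpq : ∀ i, q i = 0 → p i = 0) (hw : ∀ i, 0 < w i) :
    ∑ i, p i * Real.log (w i) + ∑ i, p i - ∑ i, q i * w i ≤ relEntropy p q := by
  rw [← Finset.sum_add_distrib, ← Finset.sum_sub_distrib]
  refine Finset.sum_le_sum fun i _ => ?_
  rcases (hp i).eq_or_lt with hzero | hpos
  · simpa [← hzero] using mul_nonneg (hq i) (hw i).le
  have hqpos : 0 < q i := (hq i).lt_of_ne' (mt (hpq i) hpos.ne')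
  have hratio : Real.log (q i * w i / p i) = Real.log (w i) - Real.log (p i / q i) := by
    rw [Real.log_div (mul_pos hqpos (hw i)).ne' hpos.ne', Real.log_mul hqpos.ne' (hw i).ne',
      Real.log_div hpos.ne' hqpos.ne']
    ring
  have hlog := Real.log_le_sub_one_of_pos (div_pos (mul_pos hqpos (hw i)) hpos)
  rw [hratio, le_sub_iff_add_le, le_div_iff₀ hpos] at hlog
  linarith

lemma log_two_div_three_le_relEntropy {p q : ι → ℝ} (hp : p ∈ stdSimplex ℝ ι)
    (hq : q ∈ stdSimplex ℝ ι) (hpq : ∀ i, q i = 0 → p i = 0) {s t : Set ι} (hst : Disjoint s t)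
    (hs : 2 / 3 ≤ ∑ i, s.indicator p i) (ht : 2 / 3 ≤ ∑ i, t.indicator q i) :
    Real.log 2 / 3 ≤ relEntropy p q := by
  classical
  let w : ι → ℝ := fun i => if i ∈ s then 2 else 2⁻¹
  have hlog : ∑ i, p i * Real.log (w i) = Real.log 2 * (2 * ∑ i, s.indicator p i - ∑ i, p i) := by
    rw [Finset.mul_sum, ← Finset.sum_sub_distrib, Finset.mul_sum]
    refine Finset.sum_congr rfl fun i _ => ?_
    simp only [w, Set.indicator_apply]
    split_ifs
    · ring
    · rw [Real.log_inv]
      ring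
  have hmean : ∑ i, q i * w i = 2⁻¹ * ∑ i, q i + 3 / 2 * ∑ i, s.indicator q i := by
    rw [Finset.mul_sum, Finset.mul_sum, ← Finset.sum_add_distrib]
    refine Finset.sum_congr rfl fun i _ => ?_
    simp only [w, Set.indicator_apply]
    split_ifs <;> ring
  have hdisj : ∑ i, s.indicator q i + ∑ i, t.indicator q i ≤ ∑ i, q i := by
    rw [← Finset.sum_add_distrib]
    refine Finset.sum_le_sum fun i _ => ?_
    rw [← congrFun (Set.indicator_union_of_disjoint hst q) i]
    exact Set.indicator_le_self' (fun i _ => hq.1 i) i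
  have hgibbs := sum_mul_log_add_sum_sub_sum_le_relEntropy hp.1 hq.1 hpq (w := w)
    fun i => by positivity
  rw [hlog, hmean, hp.2, hq.2] at hgibbs
  rw [hq.2] at hdisj
  nlinarith [Real.log_pos one_lt_two]

lemma relEntropy_mul_one_add_le {p δ : ι → ℝ} (hp : ∀ i, 0 ≤ p i) (hδ : ∀ i, -(1 / 2) ≤ δ i)
    (hmean : ∑ i, p i * δ i = 0) :
    relEntropy p (fun i => p i * (1 + δ i)) ≤ 2 * ∑ i, p i * δ i ^ 2 := by
  have hterm : ∀ i, p i * Real.log (p i / (p i * (1 + δ i))) ≤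
      2 * (p i * δ i ^ 2) - p i * δ i := by
    intro i
    have hpos : 0 < 1 + δ i := by linarith [hδ i]
    rcases (hp i).eq_or_lt with hzero | hppos
    · simp [← hzero]
    have hlog : Real.log (p i / (p i * (1 + δ i))) ≤ (1 + δ i)⁻¹ - 1 := by
      rw [← div_div, div_self hppos.ne', one_div]
      exact Real.log_le_sub_one_of_pos (inv_pos.2 hpos)
    have hinv : (1 + δ i)⁻¹ - 1 ≤ 2 * δ i ^ 2 - δ i := by
      rw [sub_le_iff_le_add, inv_le_iff_one_le_mul₀ hpos]
      nlinarith [mul_nonneg (sq_nonneg (δ i)) (by linarith [hδ i] : 0 ≤ 1 + 2 * δ i)]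
    nlinarith [mul_le_mul_of_nonneg_left (hlog.trans hinv) hppos.le]
  calc relEntropy p (fun i => p i * (1 + δ i))
      ≤ ∑ i, (2 * (p i * δ i ^ 2) - p i * δ i) := Finset.sum_le_sum fun i _ => hterm i
    _ = 2 * ∑ i, p i * δ i ^ 2 := by rw [Finset.sum_sub_distrib, hmean, sub_zero, ← Finset.mul_sum]

end RelEntropy

lemma posSemidef_blockChannel {η : ℝ} {B : Finset (PauliIdx n)} (hB : 0 ∉ B)
    (hη : |η| * B.card ≤ 1) {X : Op n} (hX : X.PosSemidef) : (blockChannel η B X).PosSemidef :=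
  posSemidef_pauliChannel (blockRates_mem_stdSimplex hB hη).1 hX

lemma isTP_blockChannel {η : ℝ} {B : Finset (PauliIdx n)} (hB : 0 ∉ B)
    (hη : |η| * B.card ≤ 1) : IsTP (blockChannel η B) :=
  isTP_pauliChannel (blockRates_mem_stdSimplex hB hη).2

lemma posSemidef_depolarizing {X : Op n} (hX : X.PosSemidef) : (depolarizing n X).PosSemidef :=
  posSemidef_pauliChannel (fun _ => by positivity) hX

lemma isTP_depolarizing : IsTP (depolarizing n) :=
  blockChannel_zero (∅ : Finset (PauliIdx n)) ▸ isTP_blockChannel (by simp) (by simp)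

/-! ### Information gained by a single measurement -/

/-- The expectation value of `P_b` in the normalization `X / Tr X` of a positive semidefinite
operator, with value `0` for `X = 0`. -/
def pauliMean (X : Op n) (b : PauliIdx n) : ℝ := pauliCoeff X b / X.trace.re

lemma re_trace_mul_pauliMean {X : Op n} (hX : X.PosSemidef) (b : PauliIdx n) :
    X.trace.re * pauliMean X b = pauliCoeff X b :=
  mul_div_cancel_of_imp' fun htrace =>
    abs_eq_zero.1 (le_antisymm ((abs_pauliCoeff_le hX b).trans htrace.le) (abs_nonneg _))

lemma abs_pauliMean_le_one {X : Op n} (hX : X.PosSemidef) (b : PauliIdx n) :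
    |pauliMean X b| ≤ 1 := by
  have htrace : 0 ≤ X.trace.re := re_trace_nonneg hX
  rw [pauliMean, abs_div, abs_of_nonneg htrace]
  exact div_le_one_of_le₀ (abs_pauliCoeff_le hX b) htrace

lemma sum_sq_pauliMean_le {X : Op n} (hX : X.PosSemidef) : ∑ b, pauliMean X b ^ 2 ≤ 2 ^ n := by
  simp only [pauliMean, div_pow, ← Finset.sum_div]
  exact div_le_of_le_mul₀ (sq_nonneg _) (by positivity) (sum_sq_pauliCoeff_le hX)

/-- The probability of the effect `E` in the maximally mixed state. -/
def mixedProb (E : Op n) : ℝ := E.trace.re / 2 ^ n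

lemma mixedProb_nonneg {E : Op n} (hE : E.PosSemidef) : 0 ≤ mixedProb E :=
  div_nonneg (re_trace_nonneg hE) (by positivity)

lemma mixedProb_mul_pauliMean {E : Op n} (hE : E.PosSemidef) (b : PauliIdx n) :
    mixedProb E * pauliMean E b = pauliCoeff E b / 2 ^ n := by
  rw [mixedProb, div_mul_eq_mul_div, re_trace_mul_pauliMean hE]

/-- The relative change of the probability of the effect `E` in the state `X / Tr X` when the
completely depolarizing channel is replaced by `blockChannel η B`. -/
def signal (η : ℝ) (B : Finset (PauliIdx n)) (X E : Op n) : ℝ :=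
  η * ∑ b ∈ B, pauliMean X b * pauliMean E b

lemma re_trace_mul_blockChannel (η : ℝ) (B : Finset (PauliIdx n)) {E X : Op n}
    (hE : E.PosSemidef) (hX : X.PosSemidef) :
    (E * blockChannel η B X).trace.re = X.trace.re * (mixedProb E * (1 + signal η B X E)) := by
  have hfactor : ∑ b ∈ B, pauliCoeff E b * pauliCoeff X b =
      E.trace.re * X.trace.re * ∑ b ∈ B, pauliMean X b * pauliMean E b := by
    rw [Finset.mul_sum]
    refine Finset.sum_congr rfl fun b _ => ?_
    rw [← re_trace_mul_pauliMean hE, ← re_trace_mul_pauliMean hX]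
    ring
  have htwo := two_pow_mul_re_trace_mul_blockChannel η B hE.1 X
  rw [mul_comm, ← eq_div_iff (by positivity), hfactor] at htwo
  rw [htwo, mixedProb, signal]
  ring

lemma re_trace_mul_depolarizing {E X : Op n} (hE : E.PosSemidef) (hX : X.PosSemidef) :
    (E * depolarizing n X).trace.re = X.trace.re * mixedProb E := by
  rw [← blockChannel_zero ∅, re_trace_mul_blockChannel 0 ∅ hE hX, signal, zero_mul, add_zero,
    mul_one]

lemma abs_signal_le (η : ℝ) (B : Finset (PauliIdx n)) {X E : Op n} (hX : X.PosSemidef)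
    (hE : E.PosSemidef) : |signal η B X E| ≤ |η| * B.card := by
  rw [signal, abs_mul]
  refine mul_le_mul_of_nonneg_left ((Finset.abs_sum_le_sum_abs _ _).trans ?_) (abs_nonneg η)
  calc ∑ b ∈ B, |pauliMean X b * pauliMean E b| ≤ ∑ _b ∈ B, (1 : ℝ) :=
        Finset.sum_le_sum fun b _ => by
          rw [abs_mul]
          exact mul_le_one₀ (abs_pauliMean_le_one hX b) (abs_nonneg _) (abs_pauliMean_le_one hE b)
    _ = B.card := by simp

lemma sq_signal_le (η : ℝ) (B : Finset (PauliIdx n)) {X : Op n} (hX : X.PosSemidef) (E : Op n) :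
    signal η B X E ^ 2 ≤ η ^ 2 * B.card * ∑ b ∈ B, pauliMean E b ^ 2 := by
  rw [signal, mul_pow, mul_assoc]
  refine mul_le_mul_of_nonneg_left (sq_sum_le_card_mul_sum_sq.trans ?_) (sq_nonneg η)
  refine mul_le_mul_of_nonneg_left (Finset.sum_le_sum fun b _ => ?_) (Nat.cast_nonneg _)
  rw [mul_pow]
  exact mul_le_of_le_one_left (sq_nonneg _) ((sq_le_one_iff_abs_le_one _).2
    (abs_pauliMean_le_one hX b))

section POVM

variable {α : Type} [Fintype α] {E : α → Op n}

lemma sum_mixedProb (hE : ∑ o, E o = 1) : ∑ o, mixedProb (E o) = 1 := by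
  simp only [mixedProb]
  rw [← Finset.sum_div, ← Complex.re_sum, ← Matrix.trace_sum, hE, Matrix.trace_one,
    Complex.natCast_re, div_eq_one_iff_eq (by positivity)]
  simp

lemma sum_mixedProb_mul_signal (hE : IsPOVM E) (η : ℝ) {B : Finset (PauliIdx n)} (hB : 0 ∉ B)
    (X : Op n) : ∑ o, mixedProb (E o) * signal η B X (E o) = 0 := by
  have hcoeff : ∀ b ∈ B, ∑ o, pauliCoeff (E o) b = 0 := fun b hb => by
    simp only [pauliCoeff]
    rw [← Complex.re_sum, ← Matrix.trace_sum, ← Finset.sum_mul, hE.2, one_mul, trace_pauli,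
      if_neg (ne_of_mem_of_not_mem hb hB), Complex.zero_re]
  calc ∑ o, mixedProb (E o) * signal η B X (E o)
      = ∑ b ∈ B, η * pauliMean X b * ((∑ o, pauliCoeff (E o) b) / 2 ^ n) := by
        simp only [signal, Finset.mul_sum, Finset.sum_div]
        rw [Finset.sum_comm]
        refine Finset.sum_congr rfl fun b _ => Finset.sum_congr rfl fun o _ => ?_
        rw [← mixedProb_mul_pauliMean (hE.1 o)]
        ring
    _ = 0 := Finset.sum_eq_zero fun b hb => by rw [hcoeff b hb, zero_div, mul_zero]

/-- The information about the block `B` gained by the POVM `E`. The bound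
`sum_pauliInfo_parts_le` on the total over disjoint blocks is what makes learning expensive. -/
def pauliInfo (B : Finset (PauliIdx n)) (E : α → Op n) : ℝ :=
  ∑ o, mixedProb (E o) * ∑ b ∈ B, pauliMean (E o) b ^ 2

lemma sum_pauliInfo_parts_le (hE : IsPOVM E) {s : Finset (PauliIdx n)} (𝓑 : Finpartition s) :
    ∑ B ∈ 𝓑.parts, pauliInfo B E ≤ 2 ^ n := by
  have hpurity : ∀ o, ∑ B ∈ 𝓑.parts, ∑ b ∈ B, pauliMean (E o) b ^ 2 ≤ 2 ^ n := fun o => by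
    refine (Finset.sum_biUnion 𝓑.disjoint).ge.trans ?_
    exact (Finset.sum_le_univ_sum_of_nonneg fun b => sq_nonneg _).trans
      (sum_sq_pauliMean_le (hE.1 o))
  calc ∑ B ∈ 𝓑.parts, pauliInfo B E
      = ∑ o, mixedProb (E o) * ∑ B ∈ 𝓑.parts, ∑ b ∈ B, pauliMean (E o) b ^ 2 := by
        simp only [pauliInfo, Finset.mul_sum]
        exact Finset.sum_comm
    _ ≤ ∑ o, mixedProb (E o) * 2 ^ n := Finset.sum_le_sum fun o _ =>
        mul_le_mul_of_nonneg_left (hpurity o) (mixedProb_nonneg (hE.1 o))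
    _ = 2 ^ n := by rw [← Finset.sum_mul, sum_mixedProb hE.2, one_mul]

lemma relEntropy_mixedProb_le (hE : IsPOVM E) {η : ℝ} {B : Finset (PauliIdx n)} (hB : 0 ∉ B)
    (hη : |η| * B.card ≤ 1 / 2) {X : Op n} (hX : X.PosSemidef) :
    relEntropy (fun o => mixedProb (E o)) (fun o => mixedProb (E o) * (1 + signal η B X (E o))) ≤
      2 * η ^ 2 * B.card * pauliInfo B E := by
  calc relEntropy (fun o => mixedProb (E o)) (fun o => mixedProb (E o) * (1 + signal η B X (E o)))
      ≤ 2 * ∑ o, mixedProb (E o) * signal η B X (E o) ^ 2 :=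
        relEntropy_mul_one_add_le (fun o => mixedProb_nonneg (hE.1 o))
          (fun o => (abs_le.1 ((abs_signal_le η B hX (hE.1 o)).trans hη)).1)
          (sum_mixedProb_mul_signal hE η hB X)
    _ ≤ 2 * ∑ o, mixedProb (E o) * (η ^ 2 * B.card * ∑ b ∈ B, pauliMean (E o) b ^ 2) := by
        gcongr with o
        · exact mixedProb_nonneg (hE.1 o)
        · exact sq_signal_le η B hX (E o)
    _ = 2 * η ^ 2 * B.card * pauliInfo B E := by
        rw [pauliInfo, Finset.mul_sum, Finset.mul_sum]
        exact Finset.sum_congr rfl fun o _ => by ring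

end POVM

/-! ### Adaptive measurements -/

section Adaptive

variable {η : ℝ} {B : Finset (PauliIdx n)}

lemma re_trace_mul_depolarizing_eq_zero (hη : |η| * B.card ≤ 1 / 2) {E X₀ X : Op n}
    (hE : E.PosSemidef) (hX₀ : X₀.PosSemidef) (hX : X.PosSemidef)
    (hac : X.trace.re = 0 → X₀.trace.re = 0) (hzero : (E * blockChannel η B X).trace.re = 0) :
    (E * depolarizing n X₀).trace.re = 0 := by
  have hpos : 0 < 1 + signal η B X E := by
    linarith [(abs_le.1 ((abs_signal_le η B hX hE).trans hη)).1]
  rw [re_trace_mul_blockChannel η B hE hX, ← mul_assoc, mul_eq_zero_iff_right hpos.ne'] at hzero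
  rw [re_trace_mul_depolarizing hE hX₀]
  exact mul_eq_zero.2 ((mul_eq_zero.1 hzero).imp_left hac)

lemma relEntropy_adaptive_le {H α : Type} [Fintype H] [Fintype α] {E : H → α → Op n}
    (hE : ∀ h, IsPOVM (E h)) (hB : 0 ∉ B) (hη : |η| * B.card ≤ 1 / 2) {X₀ X : H → Op n}
    (hX₀ : ∀ h, (X₀ h).PosSemidef) (hX : ∀ h, (X h).PosSemidef)
    (hac : ∀ h, (X h).trace.re = 0 → (X₀ h).trace.re = 0) :
    relEntropy (fun x : H × α => (E x.1 x.2 * depolarizing n (X₀ x.1)).trace.re)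
        (fun x => (E x.1 x.2 * blockChannel η B (X x.1)).trace.re) ≤
      relEntropy (fun h => (X₀ h).trace.re) (fun h => (X h).trace.re) +
        2 * η ^ 2 * B.card * ∑ h, (X₀ h).trace.re * pauliInfo B (E h) := by
  have hpos : ∀ h o, 0 < 1 + signal η B (X h) (E h o) := fun h o => by
    linarith [(abs_le.1 ((abs_signal_le η B (hX h) ((hE h).1 o)).trans hη)).1]
  simp only [re_trace_mul_depolarizing ((hE _).1 _) (hX₀ _),
    re_trace_mul_blockChannel η B ((hE _).1 _) (hX _)]
  rw [relEntropy_chain (p := fun h o => mixedProb (E h o))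
    (q := fun h o => mixedProb (E h o) * (1 + signal η B (X h) (E h o))) hac
    (fun h o hzero => (mul_eq_zero_iff_right (hpos h o).ne').1 hzero)
    fun h => sum_mixedProb (hE h).2, Finset.mul_sum]
  refine add_le_add_right (Finset.sum_le_sum fun h _ => ?_) _
  calc _ ≤ (X₀ h).trace.re * (2 * η ^ 2 * B.card * pauliInfo B (E h)) :=
        mul_le_mul_of_nonneg_left (relEntropy_mixedProb_le (hE h) hB hη (hX h))
          (re_trace_nonneg (hX₀ h))
    _ = _ := by ring

end Adaptive

/-! ### Effects of instruments -/

lemma IsCP.posSemidef {Φ : SuperOp n} (hΦ : IsCP Φ) {X : Op n} (hX : X.PosSemidef) :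
    (Φ X).PosSemidef :=
  (hΦ 1 (fun _ _ => X) (hX.submatrix Prod.snd)).submatrix fun i => ((0 : Fin 1), i)

/-- The adjoint of a superoperator (for the trace pairing), applied to the identity. The branch `Φ`
of an instrument occurs in the state `X` with probability `Tr[effect Φ X]`. -/
def effect (Φ : SuperOp n) : Op n := Matrix.of fun i j => (Φ (Matrix.single j i 1)).trace

lemma trace_effect_mul (Φ : SuperOp n) (X : Op n) : (effect Φ * X).trace = (Φ X).trace := by
  have hsingle : ∀ i j, Φ (Matrix.single j i (X j i)) = X j i • Φ (Matrix.single j i 1) :=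
    fun i j => by rw [← map_smul, Matrix.smul_single, smul_eq_mul, mul_one]
  calc (effect Φ * X).trace
      = ∑ i, ∑ j, X j i * (Φ (Matrix.single j i 1)).trace := by
        simp only [effect, Matrix.trace, Matrix.diag, Matrix.mul_apply, Matrix.of_apply, mul_comm]
    _ = (Φ X).trace := by
        conv_rhs => rw [Matrix.matrix_eq_sum_single X]
        simp only [map_sum, Matrix.trace_sum, hsingle, Matrix.trace_smul, smul_eq_mul]
        exact Finset.sum_comm

lemma posSemidef_effect {Φ : SuperOp n} (hΦ : IsCP Φ) : (effect Φ).PosSemidef :=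
  posSemidef_of_forall_trace_mul_nonneg fun X hX => by
    rw [trace_effect_mul]
    exact (hΦ.posSemidef hX).trace_nonneg

section Instrument

variable {α : Type} [Fintype α] {Φ : α → SuperOp n}

lemma sum_effect (hΦ : IsTP (∑ o, Φ o)) : ∑ o, effect (Φ o) = 1 := by
  ext i j
  have htrace := hΦ (Matrix.single j i 1)
  rw [LinearMap.sum_apply, Matrix.trace_sum] at htrace
  simp only [effect, Matrix.sum_apply, Matrix.of_apply, htrace, Matrix.one_apply]
  split_ifs with hij
  · rw [hij, Matrix.trace_single_eq_same]
  · exact Matrix.trace_single_eq_of_ne _ _ _ (Ne.symm hij)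

lemma isPOVM_effect (hΦ : IsInstrument Φ) : IsPOVM fun o => effect (Φ o) :=
  ⟨fun o => posSemidef_effect (hΦ.1 o), sum_effect hΦ.2⟩

lemma pauliInfo_effect_eq_zero (hΦ : IsTrivialInstrument Φ) {B : Finset (PauliIdx n)}
    (hB : 0 ∉ B) : pauliInfo B (fun o => effect (Φ o)) = 0 := by
  refine Finset.sum_eq_zero fun o _ => mul_eq_zero_of_right _ (Finset.sum_eq_zero fun b hb => ?_)
  obtain ⟨r, Ψ, -, hΨ, hΦΨ⟩ := hΦ o
  have hcoeff : pauliCoeff (effect (Φ o)) b = 0 := by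
    rw [pauliCoeff, trace_effect_mul, hΦΨ, LinearMap.smul_apply, Matrix.trace_smul, hΨ, trace_pauli,
      if_neg (ne_of_mem_of_not_mem hb hB), smul_zero, Complex.zero_re]
  rw [pauliMean, hcoeff, zero_div, zero_pow two_ne_zero]

end Instrument

/-! ### Schemes -/

/-- Splitting off the last outcome of a string. -/
def History.splitLast (A : ℕ → Type) (t : ℕ) : History A (t + 1) ≃ History A t × A t :=
  (Fin.snocEquiv fun i : Fin (t + 1) => A i).symm.trans (Equiv.prodComm _ _)

lemma History.sum_splitLast {A : ℕ → Type} [∀ i, Fintype (A i)] {M : Type*} [AddCommMonoid M]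
    {t : ℕ} (F : History A t → A t → M) :
    ∑ o : History A (t + 1), F (o.take t (Nat.le_succ t)) (o (Fin.last t)) =
      ∑ h, ∑ a, F h a := by
  rw [← Fintype.sum_prod_type']
  exact (History.splitLast A t).sum_comp fun x => F x.1 x.2

namespace Scheme

variable {m : ℕ} (S : Scheme n m)

lemma isInstrument_instr_succ {t : ℕ} (ht : t < m) (h : History S.A (t + 1)) :
    IsInstrument (S.instr (t + 1) h) :=
  S.instr_instrument (t + 1) (Nat.le_add_left 1 t) ht h

/-- The probability of an outcome string `(o_0, …, o_{t+1})` if the last outcome is produced by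
measuring the effects `E`, chosen adaptively, after the channel has acted on the state at time
`t`. -/
def measureProb (Λ : SuperOp n) (t : ℕ) (E : History S.A (t + 1) → S.A (t + 1) → Op n)
    (o : History S.A (t + 2)) : ℝ :=
  (E (o.take (t + 1) (Nat.le_succ _)) (o (Fin.last (t + 1))) *
    Λ (S.state Λ t (o.take (t + 1) (Nat.le_succ _)))).trace.re

lemma prob_eq_measureProb (Λ : SuperOp n) : S.prob Λ = S.measureProb Λ m S.povm := rfl

lemma re_trace_state_succ (Λ : SuperOp n) (t : ℕ) (o : History S.A (t + 2)) :
    (S.state Λ (t + 1) o).trace.re =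
      S.measureProb Λ t (fun h a => effect (S.instr (t + 1) h a)) o := by
  rw [measureProb, trace_effect_mul, state]

lemma posSemidef_state {Λ : SuperOp n} (hΛ : ∀ X : Op n, X.PosSemidef → (Λ X).PosSemidef) :
    ∀ {t : ℕ}, t ≤ m → ∀ o, (S.state Λ t o).PosSemidef
  | 0, _, _ => S.init_ensemble.1 _
  | _ + 1, ht, _ => ((S.isInstrument_instr_succ ht _).1 _).posSemidef
      (hΛ _ (posSemidef_state hΛ (Nat.le_of_succ_le ht) _))

lemma sum_re_trace_state_succ_mul {Λ : SuperOp n} (hΛ : IsTP Λ) {t : ℕ} (ht : t < m)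
    (f : History S.A (t + 1) → ℝ) :
    ∑ o, (S.state Λ (t + 1) o).trace.re * f (o.take (t + 1) (Nat.le_succ _)) =
      ∑ h, (S.state Λ t h).trace.re * f h := by
  have hTP : ∀ h : History S.A (t + 1),
      ∑ a, (S.instr (t + 1) h a (Λ (S.state Λ t h))).trace.re = (S.state Λ t h).trace.re :=
    fun h => by
      rw [← Complex.re_sum, ← Matrix.trace_sum, ← LinearMap.sum_apply,
        (S.isInstrument_instr_succ ht h).2, hΛ]
  refine (History.sum_splitLast fun h a =>
    (S.instr (t + 1) h a (Λ (S.state Λ t h))).trace.re * f h).trans ?_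
  simp only [← Finset.sum_mul, hTP]

lemma sum_re_trace_state {Λ : SuperOp n} (hΛ : IsTP Λ) :
    ∀ {t : ℕ}, t ≤ m → ∑ o, (S.state Λ t o).trace.re = 1
  | 0, _ => by
      refine (History.sum_splitLast fun _ a => (S.init a).trace.re).trans ?_
      rw [Fintype.sum_unique, ← Complex.re_sum, ← Matrix.trace_sum, S.init_ensemble.2,
        Complex.one_re]
  | t + 1, ht => by
      simpa only [mul_one, sum_re_trace_state hΛ (Nat.le_of_succ_le ht)] using
        S.sum_re_trace_state_succ_mul hΛ ht fun _ => 1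

lemma prob_mem_stdSimplex {Λ : SuperOp n} (hΛ : ∀ X : Op n, X.PosSemidef → (Λ X).PosSemidef)
    (hΛTP : IsTP Λ) : S.prob Λ ∈ stdSimplex ℝ S.Outcome := by
  refine ⟨fun o => (Complex.nonneg_iff.1 (trace_mul_nonneg ((S.povm_povm _).1 _)
    (hΛ _ (S.posSemidef_state hΛ le_rfl _)))).1, ?_⟩
  have hnorm : ∀ h, ∑ a, (S.povm h a * Λ (S.state Λ m h)).trace.re = (S.state Λ m h).trace.re :=
    fun h => by
      rw [← Complex.re_sum, ← Matrix.trace_sum, ← Finset.sum_mul, (S.povm_povm h).2, one_mul, hΛTP]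
  refine (History.sum_splitLast fun h a =>
    (S.povm h a * Λ (S.state Λ m h)).trace.re).trans ?_
  simp only [hnorm, S.sum_re_trace_state hΛTP le_rfl]

/-- The information about the block `B` gained by the instruments along an outcome string. -/
def instrGain (B : Finset (PauliIdx n)) (t : ℕ) (o : History S.A (t + 1)) : ℝ :=
  ∑ s : Fin t, pauliInfo B fun a =>
    effect (S.instr (s + 1) (o.take (s + 1) (Nat.succ_le_succ s.isLt.le)) a)

lemma instrGain_succ (B : Finset (PauliIdx n)) (t : ℕ) (o : History S.A (t + 2)) :
    S.instrGain B (t + 1) o = S.instrGain B t (o.take (t + 1) (Nat.le_succ _)) +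
      pauliInfo B fun a => effect (S.instr (t + 1) (o.take (t + 1) (Nat.le_succ _)) a) :=
  Fin.sum_univ_castSucc _

/-- The information about the block `B` gained along an outcome string, including the final
POVM. -/
def gain (B : Finset (PauliIdx n)) (o : History S.A (m + 1)) : ℝ :=
  S.instrGain B m o + pauliInfo B (S.povm o)

open Classical in
lemma card_filter_nontrivial_add_one_le_numMeas (o : History S.A (m + 1)) :
    (Finset.univ.filter fun s : Fin m => ¬ IsTrivialInstrument
      (S.instr (s + 1) (o.take (s + 1) (Nat.succ_le_succ s.isLt.le)))).card + 1 ≤ S.numMeas := by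
  refine le_trans (le_of_eq ?_) (Finset.le_sup (Finset.mem_univ o))
  rw [Fin.card_filter_univ_succ, if_neg (by simp)]
  congr 2
  ext s
  simp

lemma sum_gain_parts_le {s : Finset (PauliIdx n)} (hs : 0 ∉ s) (𝓑 : Finpartition s)
    (o : History S.A (m + 1)) : ∑ B ∈ 𝓑.parts, S.gain B o ≤ 2 ^ n * S.numMeas := by
  classical
  have hstep : ∀ t : Fin m, (∑ B ∈ 𝓑.parts, pauliInfo B fun a =>
      effect (S.instr (t + 1) (o.take (t + 1) (Nat.succ_le_succ t.isLt.le)) a)) ≤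
        if ¬ IsTrivialInstrument (S.instr (t + 1) (o.take (t + 1) (Nat.succ_le_succ t.isLt.le)))
        then 2 ^ n else 0 := fun t => by
    split_ifs with htriv
    · exact (Finset.sum_eq_zero fun B hB =>
        pauliInfo_effect_eq_zero htriv fun h0 => hs (𝓑.le hB h0)).le
    · exact sum_pauliInfo_parts_le (isPOVM_effect (S.isInstrument_instr_succ t.isLt _)) 𝓑
  calc ∑ B ∈ 𝓑.parts, S.gain B o
      = (∑ t : Fin m, ∑ B ∈ 𝓑.parts, pauliInfo B fun a =>
          effect (S.instr (t + 1) (o.take (t + 1) (Nat.succ_le_succ t.isLt.le)) a)) +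
            ∑ B ∈ 𝓑.parts, pauliInfo B (S.povm o) := by
        simp only [gain, instrGain, Finset.sum_add_distrib]
        rw [Finset.sum_comm]
    _ ≤ (∑ t : Fin m, if ¬ IsTrivialInstrument
          (S.instr (t + 1) (o.take (t + 1) (Nat.succ_le_succ t.isLt.le))) then 2 ^ n else 0) +
            2 ^ n :=
        add_le_add (Finset.sum_le_sum fun t _ => hstep t) (sum_pauliInfo_parts_le (S.povm_povm o) 𝓑)
    _ = 2 ^ n * ((Finset.univ.filter fun t : Fin m => ¬ IsTrivialInstrument
          (S.instr (t + 1) (o.take (t + 1) (Nat.succ_le_succ t.isLt.le)))).card + 1 : ℕ) := by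
        rw [← Finset.sum_filter, Finset.sum_const, nsmul_eq_mul]
        push_cast
        ring
    _ ≤ 2 ^ n * S.numMeas := by
        gcongr
        exact S.card_filter_nontrivial_add_one_le_numMeas o

section BlockChannel

variable {η : ℝ} {B : Finset (PauliIdx n)}

lemma re_trace_state_depolarizing_eq_zero (hB : 0 ∉ B) (hη : |η| * B.card ≤ 1 / 2) :
    ∀ {t : ℕ}, t ≤ m → ∀ o, (S.state (blockChannel η B) t o).trace.re = 0 →
      (S.state (depolarizing n) t o).trace.re = 0
  | 0, _, _, hzero => hzero
  | t + 1, ht, o, hzero => by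
      rw [re_trace_state_succ] at hzero ⊢
      exact re_trace_mul_depolarizing_eq_zero hη
        (posSemidef_effect ((S.isInstrument_instr_succ ht _).1 _))
        (S.posSemidef_state (fun _ => posSemidef_depolarizing) (Nat.le_of_succ_le ht) _)
        (S.posSemidef_state (fun _ => posSemidef_blockChannel hB (hη.trans (by norm_num)))
          (Nat.le_of_succ_le ht) _)
        (re_trace_state_depolarizing_eq_zero hB hη (Nat.le_of_succ_le ht) _) hzero

lemma prob_depolarizing_eq_zero (hB : 0 ∉ B) (hη : |η| * B.card ≤ 1 / 2) (o : S.Outcome)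
    (hzero : S.prob (blockChannel η B) o = 0) : S.prob (depolarizing n) o = 0 :=
  re_trace_mul_depolarizing_eq_zero hη ((S.povm_povm _).1 _)
    (S.posSemidef_state (fun _ => posSemidef_depolarizing) le_rfl _)
    (S.posSemidef_state (fun _ => posSemidef_blockChannel hB (hη.trans (by norm_num))) le_rfl _)
    (S.re_trace_state_depolarizing_eq_zero hB hη le_rfl _) hzero

lemma relEntropy_measureProb_le (hB : 0 ∉ B) (hη : |η| * B.card ≤ 1 / 2) {t : ℕ} (ht : t ≤ m)
    {E : History S.A (t + 1) → S.A (t + 1) → Op n} (hE : ∀ h, IsPOVM (E h)) :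
    relEntropy (S.measureProb (depolarizing n) t E) (S.measureProb (blockChannel η B) t E) ≤
      relEntropy (fun h => (S.state (depolarizing n) t h).trace.re)
          (fun h => (S.state (blockChannel η B) t h).trace.re) +
        2 * η ^ 2 * B.card *
          ∑ h, (S.state (depolarizing n) t h).trace.re * pauliInfo B (E h) :=
  (relEntropy_comp_equiv (History.splitLast S.A (t + 1)) _ _).trans_le <|
    relEntropy_adaptive_le hE hB hη
      (fun h => S.posSemidef_state (fun _ => posSemidef_depolarizing) ht h)
      (fun h => S.posSemidef_state
        (fun _ => posSemidef_blockChannel hB (hη.trans (by norm_num))) ht h)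
      (S.re_trace_state_depolarizing_eq_zero hB hη ht)

lemma relEntropy_state_le (hB : 0 ∉ B) (hη : |η| * B.card ≤ 1 / 2) :
    ∀ {t : ℕ}, t ≤ m →
      relEntropy (fun o => (S.state (depolarizing n) t o).trace.re)
          (fun o => (S.state (blockChannel η B) t o).trace.re) ≤
        2 * η ^ 2 * B.card *
          ∑ o, (S.state (depolarizing n) t o).trace.re * S.instrGain B t o
  | 0, _ => by
      have hinit := relEntropy_self fun o => (S.state (depolarizing n) 0 o).trace.re
      refine hinit.trans_le (le_of_eq ?_)
      simp only [instrGain, Finset.univ_eq_empty, Finset.sum_empty, mul_zero,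
        Finset.sum_const_zero]
  | t + 1, ht => by
      have hstep := S.relEntropy_measureProb_le hB hη (Nat.le_of_succ_le ht)
        fun h => isPOVM_effect (S.isInstrument_instr_succ ht h)
      have hprev := relEntropy_state_le hB hη (Nat.le_of_succ_le ht)
      calc relEntropy (fun o => (S.state (depolarizing n) (t + 1) o).trace.re)
            (fun o => (S.state (blockChannel η B) (t + 1) o).trace.re)
          ≤ 2 * η ^ 2 * B.card *
                ∑ h, (S.state (depolarizing n) t h).trace.re * S.instrGain B t h +
              2 * η ^ 2 * B.card * ∑ h, (S.state (depolarizing n) t h).trace.re *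
                pauliInfo B fun a => effect (S.instr (t + 1) h a) := by
            simp only [re_trace_state_succ]
            exact hstep.trans (add_le_add_left hprev _)
        _ = 2 * η ^ 2 * B.card * ∑ o, (S.state (depolarizing n) (t + 1) o).trace.re *
              S.instrGain B (t + 1) o := by
            rw [← mul_add, ← Finset.sum_add_distrib]
            simp only [← mul_add, ← S.sum_re_trace_state_succ_mul isTP_depolarizing ht,
              instrGain_succ]

/-- The expected information about the block `B` gained from the completely depolarizing
channel. -/
def expectedGain (B : Finset (PauliIdx n)) : ℝ :=
  ∑ h, (S.state (depolarizing n) m h).trace.re * S.gain B h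

lemma relEntropy_prob_le (hB : 0 ∉ B) (hη : |η| * B.card ≤ 1 / 2) :
    relEntropy (S.prob (depolarizing n)) (S.prob (blockChannel η B)) ≤
      2 * η ^ 2 * B.card * S.expectedGain B := by
  rw [prob_eq_measureProb, prob_eq_measureProb]
  refine (S.relEntropy_measureProb_le hB hη le_rfl S.povm_povm).trans
    ((add_le_add_left (S.relEntropy_state_le hB hη le_rfl) _).trans_eq ?_)
  simp only [expectedGain, gain, mul_add, Finset.sum_add_distrib]

end BlockChannel

lemma sum_expectedGain_parts_le {s : Finset (PauliIdx n)} (hs : 0 ∉ s) (𝓑 : Finpartition s) :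
    ∑ B ∈ 𝓑.parts, S.expectedGain B ≤ 2 ^ n * S.numMeas := by
  calc ∑ B ∈ 𝓑.parts, S.expectedGain B
      = ∑ h, (S.state (depolarizing n) m h).trace.re * ∑ B ∈ 𝓑.parts, S.gain B h := by
        simp only [expectedGain, Finset.mul_sum]
        exact Finset.sum_comm
    _ ≤ ∑ h, (S.state (depolarizing n) m h).trace.re * (2 ^ n * S.numMeas) :=
        Finset.sum_le_sum fun h _ => mul_le_mul_of_nonneg_left (S.sum_gain_parts_le hs 𝓑 h)
          (re_trace_nonneg (S.posSemidef_state (fun _ => posSemidef_depolarizing) le_rfl h))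
    _ = 2 ^ n * S.numMeas := by
        rw [← Finset.sum_mul, S.sum_re_trace_state isTP_depolarizing le_rfl, one_mul]

lemma probEvent_eq_sum_indicator (Λ : SuperOp n) (s : Set S.Outcome) :
    S.probEvent Λ s = ∑ o, s.indicator (S.prob Λ) o := rfl

lemma log_two_div_three_le_expectedGain {𝓑 : Finset (Finset (PauliIdx n))}
    {est : Finset (PauliIdx n) → S.Outcome → ℝ} {ε : ℝ} (hlearn : S.Learns 𝓑 est ε) (hε : 0 < ε)
    {B : Finset (PauliIdx n)} (hB𝓑 : B ∈ 𝓑) (hB : 0 ∉ B) (hne : B.Nonempty)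
    (hεB : 3 * ε * B.card ≤ 1 / 2) :
    Real.log 2 / 3 ≤ 18 * ε ^ 2 * B.card * S.expectedGain B := by
  have hη : |3 * ε| * B.card ≤ 1 / 2 := by rwa [abs_of_pos (by positivity)]
  have hη1 : |3 * ε| * B.card ≤ 1 := hη.trans (by norm_num)
  have hsuccess : ∀ η : ℝ, 0 ≤ η → |η| * B.card ≤ 1 →
      2 / 3 ≤ ∑ o, {o | |est B o - η| ≤ ε}.indicator (S.prob (blockChannel η B)) o :=
    fun η hη₀ hη₁ => by
      have hprob := hlearn _ (blockRates_mem_stdSimplex hB hη₁) B hB𝓑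
      rwa [← blockChannel, geomFidelity_blockChannel hB hne hη₀, probEvent_eq_sum_indicator]
        at hprob
  have hdisj : Disjoint {o | |est B o - 0| ≤ ε} {o | |est B o - 3 * ε| ≤ ε} :=
    Set.disjoint_left.2 fun o (h₀ : |est B o - 0| ≤ ε) (h₁ : |est B o - 3 * ε| ≤ ε) => by
      linarith [(abs_le.1 h₀).2, (abs_le.1 h₁).1]
  have hnull := hsuccess 0 le_rfl (by simp)
  rw [blockChannel_zero] at hnull
  calc Real.log 2 / 3
      ≤ relEntropy (S.prob (depolarizing n)) (S.prob (blockChannel (3 * ε) B)) :=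
        log_two_div_three_le_relEntropy
          (S.prob_mem_stdSimplex (fun _ => posSemidef_depolarizing) isTP_depolarizing)
          (S.prob_mem_stdSimplex (fun _ => posSemidef_blockChannel hB hη1)
            (isTP_blockChannel hB hη1))
          (S.prob_depolarizing_eq_zero hB hη) hdisj hnull (hsuccess _ (by positivity) hη1)
    _ ≤ 2 * (3 * ε) ^ 2 * B.card * S.expectedGain B := S.relEntropy_prob_le hB hη
    _ = 18 * ε ^ 2 * B.card * S.expectedGain B := by ring

end Scheme

lemma three_quarters_mul_two_pow_le_card_erase_zero_div (hn : 1 ≤ n) :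
    3 / 4 * 2 ^ n ≤ ((Finset.univ : Finset (PauliIdx n)).erase 0).card / (2 ^ n : ℝ) := by
  have hcard : (((Finset.univ : Finset (PauliIdx n)).erase 0).card : ℝ) = 2 ^ n * 2 ^ n - 1 := by
    rw [Finset.cast_card_erase_of_mem (Finset.mem_univ _), Finset.card_univ]
    simp [← mul_pow]
    norm_num
  have htwo : (2 : ℝ) ≤ 2 ^ n := le_self_pow₀ one_le_two (Nat.one_le_iff_ne_zero.1 hn)
  rw [hcard, le_div_iff₀ (by positivity)]
  nlinarith

theorem theorem2_general {s : Finset (PauliIdx n)} (hs : 0 ∉ s) (𝓑 : Finpartition s) {C : ℕ}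
    (hC : ∀ B ∈ 𝓑.parts, B.card ≤ C) {ε : ℝ} (hε : 0 < ε) (hεC : ε ≤ 1 / (6 * C)) {m : ℕ}
    (S : Scheme n m) {est : Finset (PauliIdx n) → S.Outcome → ℝ} (hlearn : S.Learns 𝓑.parts est ε) :
    1 / 81 * (s.card / 2 ^ n / (ε ^ 2 * C ^ 2)) ≤ S.numMeas := by
  have hεC' : ε * (6 * C) ≤ 1 := mul_le_of_le_div₀ zero_le_one (by positivity) hεC
  have hblock : ∀ B ∈ 𝓑.parts, (B.card : ℝ) ≤ 81 * (ε ^ 2 * C ^ 2) * S.expectedGain B := by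
    intro B hB
    have hBC : (B.card : ℝ) ≤ C := Nat.cast_le.2 (hC B hB)
    have hgain : 2 / 9 ≤ 18 * ε ^ 2 * B.card * S.expectedGain B := by
      have := S.log_two_div_three_le_expectedGain hlearn hε hB (fun h0 => hs (𝓑.le hB h0))
        (𝓑.nonempty_of_mem_parts hB) (by nlinarith)
      linarith [Real.log_two_gt_d9]
    have hpos : 0 < S.expectedGain B :=
      pos_of_mul_pos_right ((by norm_num : (0 : ℝ) < 2 / 9).trans_le hgain) (by positivity)
    calc (B.card : ℝ) ≤ B.card * (9 / 2 * (18 * ε ^ 2 * B.card * S.expectedGain B)) :=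
          le_mul_of_one_le_right (Nat.cast_nonneg _) (by linarith)
      _ = 81 * (ε ^ 2 * B.card ^ 2) * S.expectedGain B := by ring
      _ ≤ 81 * (ε ^ 2 * C ^ 2) * S.expectedGain B := by gcongr
  have hcard : (s.card : ℝ) ≤ 81 * (ε ^ 2 * C ^ 2) * (2 ^ n * S.numMeas) := by
    calc (s.card : ℝ) = ∑ B ∈ 𝓑.parts, (B.card : ℝ) := by rw [← 𝓑.sum_card_parts, Nat.cast_sum]
      _ ≤ ∑ B ∈ 𝓑.parts, 81 * (ε ^ 2 * C ^ 2) * S.expectedGain B := Finset.sum_le_sum hblock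
      _ ≤ 81 * (ε ^ 2 * C ^ 2) * (2 ^ n * S.numMeas) := by
        rw [← Finset.mul_sum]
        exact mul_le_mul_of_nonneg_left (S.sum_expectedGain_parts_le hs 𝓑) (by positivity)
  have hratio : s.card / 2 ^ n / (ε ^ 2 * C ^ 2) ≤ 81 * (S.numMeas : ℝ) :=
    div_le_of_le_mul₀ (by positivity) (by positivity)
      (div_le_of_le_mul₀ (by positivity) (by positivity) (hcard.trans_eq (by ring)))
  linarith

end PauliLearning

end

open PauliLearning in
theorem theorem2 :
    ∃ c : ℝ, 0 < c ∧
      ∀ (n : ℕ), 1 ≤ n →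
      ∀ (𝓑 : Finpartition ((Finset.univ : Finset (PauliIdx n)).erase 0))
        (C : ℕ), (∀ B ∈ 𝓑.parts, B.card ≤ C) →
      ∀ (ε : ℝ), 0 < ε → ε ≤ 1 / (6 * (C : ℝ)) →
      ∀ (m : ℕ) (S : Scheme n m) (est : Finset (PauliIdx n) → S.Outcome → ℝ),
        S.Learns 𝓑.parts est ε →
          c * (2 ^ n / (ε ^ 2 * (C : ℝ) ^ 2)) ≤ (S.numMeas : ℝ) := by
  refine ⟨1 / 81 * (3 / 4), by norm_num, fun n hn 𝓑 C hC ε hε hεC m S est hlearn => ?_⟩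
  rw [mul_assoc, ← mul_div_assoc]
  refine le_trans ?_ (theorem2_general (Finset.notMem_erase _ _) 𝓑 hC hε hεC S hlearn)
  gcongr
  exact three_quarters_mul_two_pow_le_card_erase_zero_div hn
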